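/- Let $X$ be a Coxeter graph with Coxeter group $W$, generating set $S$, length function $\ell$ and Bruhat order $\le$, and put $\varepsilon_w=(-1)^{\ell(w)}$. Let $W_c\subseteq W$ be the set of fully commutative elements, that is, of those $w$ for which any reduced expression can be obtained from any other by applying relations $ss'=s's$ between commuting generators. Let $\mathcal A=\mathbb Z[q^{1/2},q^{-1/2}]$ and let $\mathcal H$ be the Hecke algebra, the $\mathcal A$-algebra with basis $\{T_w: w\in W\}$ and $T_wT_s=T_{ws}$ if $\ell(ws)>\ell(w)$, $T_wT_s=qT_{ws}+(q-1)T_w$ if $\ell(ws)<\ell(w)$. Let $\iota$ be its semilinear involution with $\iota(T_w)=(T_{w^{-1}})^{-1}$ and $\iota(q^{1/2})=q^{-1/2}$. Let $J$ be the two-sided ideal generated by the elements $\sum_{w\in\langle s,s'\rangle}T_w$, for all pairs of non-commuting $s,s'\in S$ such that $ss'$ has finite order; let $TL=\mathcal H/J$ be the generalized Temperley–Lieb algebra, $\sigma:\mathcal H\to TL$ the projection, $t_w=\sigma(T_w)$, and write $\iota$ also for the induced involution of $TL$. Let $P_{x,w}\in\mathbb Z[q]$ be the Kazhdan–Lusztig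 polynomials: the elements $C_w=\varepsilon_wq^{\ell(w)/2}\sum_{x\le w}\varepsilon_xq^{-\ell(x)}P_{x,w}(q^{-1})T_x$ form a basis of $\mathcal H$ with $\iota(C_w)=C_w$, $P_{w,w}=1$, and $\deg P_{x,w}\le\frac12(\ell(w)-\ell(x)-1)$ for $x<w$. Put $C'_w=q^{-\ell(w)/2}\sum_{x\le w}P_{x,w}(q)T_x$. Let $\{c_w: w\in W_c\}$ be the IC basis of $TL$: the basis with $\iota(c_w)=c_w$ and $c_w=\sum_{x\in W_c,\,x\le w}q^{-\ell(x)/2}L_{x,w}(q^{-1/2})\,t_x$, where $L_{w,w}=1$ and $L_{x,w}(q^{-1/2})\in q^{-1/2}\mathbb Z[q^{-1/2}]$ for $x<w$. Let $a_{x,w}\in\mathbb Z[q]$ ($x,w\in W_c$) be the polynomials with $a_{w,w}=1$, $a_{x,w}=0$ if $x\not\le w$, and $$(t_{w^{-1}})^{-1}=q^{-\ell(w)}\sum_{x\in W_c,\;x\le w}a_{x,w}(q)\,t_x .$$ Assume that $X$ satisfies $\sigma(C'_w)=c_w$ for all $w\in W_c$ and $\sigma(C'_w)=0$ for all $w\in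 W\setminus W_c$. Let $x,w\in W_c$. If $s\in S$ is such that $ws<w$ and $x<xs\notin W_c$, then $$a_{x,w}=-q\,a_{x,ws}.$$ -/

import Mathlib

open scoped LaurentPolynomial

namespace CoxeterTL

variable {B W : Type*} [Group W] {M : CoxeterMatrix B} (cs : CoxeterSystem M W)

/-! ### The strong exchange property -/

open Classical in
/-- The permutation `(t, ε) ↦ (s t s, ε + [t = s])` of `W × ℤ/2` attached to a generator `s`. -/
noncomputable def signedConj (i : B) : Equiv.Perm (W × ZMod 2) :=
  Function.Involutive.toPerm
    (fun p => (cs.simple i * p.1 * cs.simple i, p.2 + if p.1 = cs.simple i then 1 else 0)) (by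
      rintro ⟨t, e⟩
      have h2 : (1 : ZMod 2) + 1 = 0 := by decide
      by_cases h : t = cs.simple i
      · subst h; simp [add_assoc, h2]
      · have : ¬ cs.simple i * t * cs.simple i = cs.simple i := by
          intro h'
          apply h
          have := congrArg (fun z => cs.simple i * z * cs.simple i) h'
          simpa only [mul_assoc, CoxeterSystem.simple_mul_simple_self, mul_one, one_mul,
            CoxeterSystem.simple_mul_simple_cancel_left] using this
        simp only [h, this, if_false, add_zero]
        simp [mul_assoc])

open Classical in
theorem signedConj_apply (i : B) (t : W) (e : ZMod 2) :
    signedConj cs i (t, e) =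
      (cs.simple i * t * cs.simple i, e + if t = cs.simple i then 1 else 0) := by
  rfl

open Classical in
theorem signedConj_pow (i j : B) (n : ℕ) (t : W) (e : ZMod 2) :
    ((signedConj cs i * signedConj cs j) ^ n) (t, e) =
      ((cs.simple i * cs.simple j) ^ n * t * (cs.simple j * cs.simple i) ^ n,
        e + ∑ k ∈ Finset.range (2 * n),
          if t = (cs.simple j * cs.simple i) ^ k * cs.simple j then 1 else 0) := by
  induction n with
  | zero => simp
  | succ n ih =>
    have hinv : (cs.simple i * cs.simple j) ^ n = ((cs.simple j * cs.simple i) ^ n)⁻¹ := by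
      rw [← inv_pow]; simp
    have hsj : (cs.simple i * cs.simple j) * cs.simple j = cs.simple i := by simp
    have hcomm : cs.simple j * (cs.simple i * cs.simple j) ^ n =
        (cs.simple j * cs.simple i) ^ n * cs.simple j := by
      clear ih hinv
      induction n with
      | zero => simp
      | succ n ih => rw [pow_succ, ← mul_assoc, ih, pow_succ]; simp [mul_assoc]
    rw [pow_succ', Equiv.Perm.mul_apply, ih, Equiv.Perm.mul_apply, signedConj_apply,
      signedConj_apply]
    have e1 : ((cs.simple i * cs.simple j) ^ n * t * (cs.simple j * cs.simple i) ^ n =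
        cs.simple j) ↔ t = (cs.simple j * cs.simple i) ^ (2 * n) * cs.simple j := by
      rw [two_mul, pow_add, mul_assoc (_ ^ n) (_ ^ n) (cs.simple j), ← hcomm, hinv]
      generalize (cs.simple j * cs.simple i) ^ n = X
      constructor
      · intro h; rw [← h]; group
      · intro h; rw [h]; group
    have e2 : (cs.simple j * ((cs.simple i * cs.simple j) ^ n * t *
          (cs.simple j * cs.simple i) ^ n) * cs.simple j = cs.simple i) ↔
        t = (cs.simple j * cs.simple i) ^ (2 * n + 1) * cs.simple j := by
      have e3 : (cs.simple j * cs.simple i) ^ (2 * n + 1) * cs.simple j =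
          (cs.simple j * cs.simple i) ^ n * (cs.simple j * cs.simple i * cs.simple j) *
            (cs.simple i * cs.simple j) ^ n := by
        have : 2 * n + 1 = n + 1 + n := by ring
        rw [this, pow_add, mul_assoc, ← hcomm, pow_succ]
        simp only [mul_assoc]
      rw [e3, hinv]
      clear e3
      generalize (cs.simple j * cs.simple i) ^ n = X
      constructor
      · intro h
        rw [← h]
        simp only [mul_assoc, CoxeterSystem.simple_mul_simple_self, mul_one,
          CoxeterSystem.simple_mul_simple_cancel_left, mul_inv_cancel_left, mul_inv_cancel]
      · intro h
        rw [h]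
        simp [mul_assoc]
    have hr : 2 * (n + 1) = 2 * n + 1 + 1 := by ring
    rw [hr, Finset.sum_range_succ, Finset.sum_range_succ]
    simp only [e1, e2]
    refine Prod.ext ?_ ?_
    · rw [pow_succ' (cs.simple i * cs.simple j), pow_succ (cs.simple j * cs.simple i) n]
      simp only [mul_assoc]
    · simp only [add_assoc]

theorem signedConj_isLiftable : M.IsLiftable (signedConj cs) := by
  classical
  intro i j
  ext1 ⟨t, e⟩
  have h1 : (cs.simple i * cs.simple j) ^ M i j = 1 := cs.simple_mul_simple_pow i j
  have h2 : (cs.simple j * cs.simple i) ^ M i j = 1 := cs.simple_mul_simple_pow' i j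
  have h3 : ∀ z : ZMod 2, z + z = 0 := by decide
  rw [signedConj_pow, h1, h2, two_mul, Finset.sum_range_add]
  simp only [pow_add, h2, one_mul, h3]
  simp

/-- The action of `W` on `W × ℤ/2` extending `signedConj`. -/
noncomputable def signedConjHom : W →* Equiv.Perm (W × ZMod 2) :=
  cs.lift ⟨signedConj cs, signedConj_isLiftable cs⟩

open Classical in
theorem signedConjHom_wordProd (ω : List B) (t : W) (e : ZMod 2) :
    signedConjHom cs (cs.wordProd ω) (t, e) =
      (cs.wordProd ω * t * (cs.wordProd ω)⁻¹, e + ((cs.rightInvSeq ω).count t : ZMod 2)) := by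
  induction ω with
  | nil => simp
  | cons i ω ih =>
    rw [cs.wordProd_cons, map_mul, Equiv.Perm.mul_apply, ih]
    have : signedConjHom cs (cs.simple i) = signedConj cs i :=
      cs.lift_apply_simple (signedConj_isLiftable cs) i
    rw [this, signedConj_apply, CoxeterSystem.rightInvSeq, List.count_cons]
    refine Prod.ext ?_ ?_
    · simp [mul_assoc]
    · have : (cs.wordProd ω * t * (cs.wordProd ω)⁻¹ = cs.simple i) ↔
          (cs.wordProd ω)⁻¹ * cs.simple i * cs.wordProd ω = t := by
        constructor
        · intro h; rw [← h]; group
        · intro h; rw [← h]; group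
      simp only [this, beq_iff_eq]
      push_cast
      simp only [add_assoc]

theorem signedConjHom_shift (w t : W) (e : ZMod 2) :
    signedConjHom cs w (t, e) = (w * t * w⁻¹, e + (signedConjHom cs w (t, 0)).2) := by
  classical
  obtain ⟨ω, rfl⟩ := cs.wordProd_surjective w
  simp [signedConjHom_wordProd]

theorem signedConjHom_reflection {t : W} (ht : cs.IsReflection t) (e : ZMod 2) :
    signedConjHom cs t (t, e) = (t, e + 1) := by
  classical
  obtain ⟨u, i, rfl⟩ := ht
  set s := cs.simple i
  set t := u * s * u⁻¹
  have h0 : signedConjHom cs s (s, 0) = (s, 1) := by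
    have := signedConjHom_wordProd cs [i] s 0
    simpa [s] using this
  have hinv : ∀ e, signedConjHom cs u⁻¹ (t, e) = (s, e + (signedConjHom cs u⁻¹ (t, 0)).2) := by
    intro e
    rw [signedConjHom_shift]; simp [t, mul_assoc]
  set a := (signedConjHom cs u⁻¹ (t, 0)).2
  have hu : signedConjHom cs u (s, e + 1 + a) = (t, e + 1) := by
    rw [← hinv, ← Equiv.Perm.mul_apply, ← map_mul]; simp
  have : signedConjHom cs t (t, e) = signedConjHom cs u (s, e + 1 + a) := by
    conv_lhs => rw [show signedConjHom cs t = signedConjHom cs u * signedConjHom cs s *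
      signedConjHom cs u⁻¹ by rw [← map_mul, ← map_mul]]
    rw [Equiv.Perm.mul_apply, Equiv.Perm.mul_apply, hinv, signedConjHom_shift cs s, h0]
    congr 2
    · simp
    · ring
  rw [this, hu]

/-- Strong exchange property. -/
theorem mem_rightInvSeq_of_isRightInversion (ω : List B) {t : W}
    (h : cs.IsRightInversion (cs.wordProd ω) t) : t ∈ cs.rightInvSeq ω := by
  classical
  obtain ⟨ht, hlt⟩ := h
  by_contra hmem
  have h0 : (cs.rightInvSeq ω).count t = 0 := List.count_eq_zero.2 hmem
  obtain ⟨ω', hω', hω'eq⟩ := cs.exists_isReduced (cs.wordProd ω * t)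
  have h1 : signedConjHom cs (cs.wordProd ω * t) (t, 0) = signedConjHom cs (cs.wordProd ω) (t, 1) := by
    rw [map_mul, Equiv.Perm.mul_apply, signedConjHom_reflection cs ht]; simp
  rw [hω'eq, signedConjHom_wordProd, signedConjHom_wordProd, h0] at h1
  have h2 : ((cs.rightInvSeq ω').count t : ZMod 2) = 1 := by simpa using congrArg Prod.snd h1
  have h3 : t ∈ cs.rightInvSeq ω' := by
    by_contra h3
    rw [List.count_eq_zero.2 h3] at h2
    exact absurd h2 (by decide)
  have h4 := (cs.isRightInversion_of_mem_rightInvSeq hω' h3).2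
  rw [← hω'eq, mul_assoc, ht.mul_self, mul_one] at h4
  omega

theorem finite_rightInversions (w : W) : {t : W | cs.IsRightInversion w t}.Finite := by
  obtain ⟨ω, rfl⟩ := cs.wordProd_surjective w
  exact (List.finite_toSet (cs.rightInvSeq ω)).subset
    fun t ht => mem_rightInvSeq_of_isRightInversion cs ω ht

/-- If `s w > w`, `w r > w` and `s w r < s w` for generators `s`, `r`, then `s w = w r`. -/
theorem simple_mul_eq_mul_simple {w : W} {i j : B} (h2 : cs.length w < cs.length (w * cs.simple j))
    (h3 : cs.length (cs.simple i * w * cs.simple j) < cs.length (cs.simple i * w)) :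
    cs.simple i * w = w * cs.simple j := by
  obtain ⟨ω, hω, rfl⟩ := cs.exists_isReduced w
  have h4 := mem_rightInvSeq_of_isRightInversion cs (i :: ω) (t := cs.simple j)
    ⟨cs.isReflection_simple j, by rw [cs.wordProd_cons]; exact h3⟩
  rw [CoxeterSystem.rightInvSeq, List.mem_cons] at h4
  rcases h4 with h4 | h4
  · rw [h4]; group
  · have := (cs.isRightInversion_of_mem_rightInvSeq hω h4).2
    omega

/-! ### Bruhat order and fully commutative elements -/

/-- One step in the Bruhat order: `w = x t` for a reflection `t`, and `ℓ(x) < ℓ(w)`. -/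
def BruhatStep (x w : W) : Prop :=
  (∃ t, cs.IsReflection t ∧ w = x * t) ∧ cs.length x < cs.length w

/-- The Bruhat order `x ≤ w`. -/
def BruhatLE (x w : W) : Prop := Relation.ReflTransGen (BruhatStep cs) x w

/-- The strict Bruhat order `x < w`. -/
def BruhatLT (x w : W) : Prop := BruhatLE cs x w ∧ x ≠ w

theorem finite_bruhatLE (w : W) : {x : W | BruhatLE cs x w}.Finite := by
  induction hn : cs.length w using Nat.strong_induction_on generalizing w with
  | _ n ih =>
    subst hn
    have hsub : {x : W | BruhatLE cs x w} ⊆ {w} ∪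
        ⋃ t ∈ {t : W | cs.IsRightInversion w t}, {x : W | BruhatLE cs x (w * t)} := by
      intro x hx
      rcases Relation.ReflTransGen.cases_tail hx with h | ⟨y, hxy, ⟨t, ht, hwt⟩, hlt⟩
      · left; exact h.symm
      · right
        have hy : w * t = y := by rw [hwt, mul_assoc, ht.mul_self, mul_one]
        refine Set.mem_biUnion (x := t) ⟨ht, by rw [hy]; exact hlt⟩ ?_
        change BruhatLE cs x (w * t)
        rw [hy]; exact hxy
    refine Set.Finite.subset ((Set.finite_singleton w).union
      ((finite_rightInversions cs w).biUnion fun t ht => ?_)) hsub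
    exact ih _ ht.2 _ rfl

/-- The finite set `{x | x ≤ w}`. -/
noncomputable def bruhatIic (w : W) : Finset W := (finite_bruhatLE cs w).toFinset

theorem mem_bruhatIic {x w : W} : x ∈ bruhatIic cs w ↔ BruhatLE cs x w := by
  simp [bruhatIic]

/-- Two words differ by one Coxeter relation `s s' = s' s` between commuting generators. -/
def CommutationMove (ω ω' : List B) : Prop :=
  ∃ (u v : List B) (i j : B), Commute (cs.simple i) (cs.simple j) ∧
    ω = u ++ i :: j :: v ∧ ω' = u ++ j :: i :: v

/-- `w` is fully commutative, that is, `w ∈ W_c`: any reduced expression of `w` is obtained from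
any other one by relations between commuting generators. -/
def IsFullyCommutative (w : W) : Prop :=
  ∀ ω ω' : List B, cs.IsReduced ω → cs.wordProd ω = w → cs.IsReduced ω' → cs.wordProd ω' = w →
    Relation.ReflTransGen (CommutationMove cs) ω ω'

open Classical in
/-- The finite set `{x ∈ W_c | x ≤ w}`. -/
noncomputable def bruhatIicFC (w : W) : Finset W :=
  (bruhatIic cs w).filter (IsFullyCommutative cs)


/-! ### The Hecke algebra -/

/-- The ring `𝒜 = ℤ[q^{1/2}, q^{-1/2}]`; the variable `T 1` is `q^{1/2}`. -/
def Scalars : Type := ℤ[T;T⁻¹]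

noncomputable instance : CommRing Scalars := inferInstanceAs (CommRing ℤ[T;T⁻¹])

/-- The power `q^{n/2}` in `𝒜`. -/
noncomputable def qHalf (n : ℤ) : Scalars := (LaurentPolynomial.T n : ℤ[T;T⁻¹])

theorem qHalf_add (m n : ℤ) : qHalf (m + n) = qHalf m * qHalf n :=
  LaurentPolynomial.T_add (R := ℤ) m n

theorem qHalf_zero : qHalf 0 = 1 := LaurentPolynomial.T_zero (R := ℤ)

/-- The ring involution of `𝒜` with `q^{1/2} ↦ q^{-1/2}`. -/
noncomputable def scalarBar : Scalars →+* Scalars :=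
  ((LaurentPolynomial.invert (R := ℤ)) : ℤ[T;T⁻¹] →+* ℤ[T;T⁻¹])

theorem scalarBar_qHalf (n : ℤ) : scalarBar (qHalf n) = qHalf (-n) :=
  LaurentPolynomial.invert_T (R := ℤ) n

/-- The element `q` of `𝒜`. -/
noncomputable def q : Scalars := qHalf 2

theorem q_mul_qHalf : q * qHalf (-2) = 1 := by
  rw [q, ← qHalf_add]; exact qHalf_zero

/-- Left multiplication by `T_s` on the free module with basis `W`:
`T_s T_w = T_{sw}` if `ℓ(sw) > ℓ(w)`, and `T_s T_w = q T_{sw} + (q - 1) T_w` otherwise. -/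
noncomputable def leftOp (i : B) : Module.End Scalars (W →₀ Scalars) :=
  Finsupp.linearCombination Scalars fun w =>
    if cs.length w < cs.length (cs.simple i * w) then Finsupp.single (cs.simple i * w) 1
    else q • Finsupp.single (cs.simple i * w) 1 + (q - 1) • Finsupp.single w 1

/-- Right multiplication by `T_s` on the free module with basis `W`. -/
noncomputable def rightOp (i : B) : Module.End Scalars (W →₀ Scalars) :=
  Finsupp.linearCombination Scalars fun w =>
    if cs.length w < cs.length (w * cs.simple i) then Finsupp.single (w * cs.simple i) 1
    else q • Finsupp.single (w * cs.simple i) 1 + (q - 1) • Finsupp.single w 1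

theorem leftOp_single (i : B) (w : W) : leftOp cs i (Finsupp.single w 1) =
    if cs.length w < cs.length (cs.simple i * w) then Finsupp.single (cs.simple i * w) 1
    else q • Finsupp.single (cs.simple i * w) 1 + (q - 1) • Finsupp.single w 1 := by
  rw [leftOp, Finsupp.linearCombination_single, one_smul]

theorem rightOp_single (i : B) (w : W) : rightOp cs i (Finsupp.single w 1) =
    if cs.length w < cs.length (w * cs.simple i) then Finsupp.single (w * cs.simple i) 1
    else q • Finsupp.single (w * cs.simple i) 1 + (q - 1) • Finsupp.single w 1 := by
  rw [rightOp, Finsupp.linearCombination_single, one_smul]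

theorem leftOp_rightOp_comm (i j : B) :
    leftOp cs i * rightOp cs j = rightOp cs j * leftOp cs i := by
  refine Finsupp.lhom_ext' fun w => LinearMap.ext_ring ?_
  change leftOp cs i (rightOp cs j (Finsupp.single w 1)) =
    rightOp cs j (leftOp cs i (Finsupp.single w 1))
  have a1 := cs.length_simple_mul w i
  have a2 := cs.length_mul_simple w j
  have a3 := cs.length_mul_simple (cs.simple i * w) j
  have a4 := cs.length_simple_mul (w * cs.simple j) i
  have k1 : cs.length w < cs.length (w * cs.simple j) →
      cs.length (cs.simple i * w * cs.simple j) < cs.length (cs.simple i * w) →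
      cs.simple i * w = w * cs.simple j := simple_mul_eq_mul_simple cs
  have k2 : cs.length (cs.simple i * w) < cs.length (cs.simple i * w * cs.simple j) →
      cs.length (w * cs.simple j) < cs.length w →
      w = cs.simple i * w * cs.simple j := by
    intro h1 h2
    have := simple_mul_eq_mul_simple cs (w := cs.simple i * w) (i := i) (j := j) h1
      (by simpa using h2)
    simpa using this
  have m : cs.simple i * (w * cs.simple j) = cs.simple i * w * cs.simple j := by
    rw [mul_assoc]
  rw [m] at a4
  rw [leftOp_single, rightOp_single]
  by_cases c1 : cs.length w < cs.length (cs.simple i * w) <;>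
  by_cases c2 : cs.length w < cs.length (w * cs.simple j) <;>
  by_cases c3 : cs.length (cs.simple i * w) < cs.length (cs.simple i * w * cs.simple j) <;>
  by_cases c4 : cs.length (w * cs.simple j) < cs.length (cs.simple i * w * cs.simple j) <;>
  simp only [c1, c2, if_true, if_false, map_add, map_smul, leftOp_single, rightOp_single, m, c3,
    c4] <;>
  first
  | omega
  | (have e := k1 c2 (by omega); rw [e]; try module)
  | (have e := k2 c3 (by omega)
     have e' : cs.simple i * w = w * cs.simple j := by
       nth_rewrite 2 [e]; simp
     rw [e']; try module)
  | module

/-- The Hecke algebra of `(W, S)`, realized as the algebra of left multiplication operators on the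
free module with basis `W`. See `heckeT` and `heckeT_mul_simple` for its basis `T_w` and its
multiplication law. -/
noncomputable def heckeSubalgebra : Subalgebra Scalars (Module.End Scalars (W →₀ Scalars)) :=
  Algebra.adjoin Scalars (Set.range (leftOp cs))

/-- The Hecke algebra `ℋ`. -/
abbrev Hecke : Type _ := heckeSubalgebra cs

noncomputable instance : Ring (Hecke cs) := Algebra.semiringToRing Scalars

theorem hecke_comm_rightOp (h : Hecke cs) (j : B) : h.1 * rightOp cs j = rightOp cs j * h.1 := by
  obtain ⟨h, hh⟩ := h
  change h * _ = _ * h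
  induction hh using Algebra.adjoin_induction with
  | mem x hx => obtain ⟨i, rfl⟩ := hx; exact leftOp_rightOp_comm cs i j
  | algebraMap r => exact Algebra.commutes r _
  | add x y _ _ hx hy => rw [add_mul, mul_add, hx, hy]
  | mul x y _ _ hx hy => rw [mul_assoc, hy, ← mul_assoc, hx, mul_assoc]

/-- The coordinates of an element of `ℋ`: its value at the basis vector of `1 ∈ W`. -/
noncomputable def heckeCoord : Hecke cs →ₗ[Scalars] (W →₀ Scalars) where
  toFun h := h.1 (Finsupp.single 1 1)
  map_add' _ _ := rfl
  map_smul' _ _ := rfl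

theorem heckeCoord_injective : Function.Injective (heckeCoord cs) := by
  rw [injective_iff_map_eq_zero]
  intro h hh
  ext1
  refine Finsupp.lhom_ext' fun w => LinearMap.ext_ring ?_
  change h.1 (Finsupp.single w 1) = 0
  induction hn : cs.length w using Nat.strong_induction_on generalizing w with
  | _ n ih =>
    subst hn
    by_cases hw : w = 1
    · subst hw; exact hh
    · obtain ⟨j, hj⟩ := cs.exists_rightDescent_of_ne_one hw
      have h1 : rightOp cs j (Finsupp.single (w * cs.simple j) 1) = Finsupp.single w 1 := by
        rw [rightOp_single, CoxeterSystem.simple_mul_simple_cancel_right]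
        exact if_pos hj
      rw [← h1]
      change (h.1 * rightOp cs j) _ = 0
      rw [hecke_comm_rightOp]
      change rightOp cs j (h.1 _) = 0
      rw [ih _ hj _ rfl, map_zero]

theorem heckeCoord_surjective : Function.Surjective (heckeCoord cs) := by
  have key : ∀ w : W, Finsupp.single w 1 ∈ LinearMap.range (heckeCoord cs) := by
    intro w
    induction hn : cs.length w using Nat.strong_induction_on generalizing w with
    | _ n ih =>
      subst hn
      by_cases hw : w = 1
      · subst hw; exact ⟨1, rfl⟩
      · obtain ⟨i, hi⟩ := cs.exists_leftDescent_of_ne_one hw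
        obtain ⟨h, hh⟩ := ih _ hi _ rfl
        refine ⟨⟨leftOp cs i, Algebra.subset_adjoin ⟨i, rfl⟩⟩ * h, ?_⟩
        change leftOp cs i (heckeCoord cs h) = _
        rw [hh, leftOp_single, CoxeterSystem.simple_mul_simple_cancel_left]
        exact if_pos hi
  rw [← LinearMap.range_eq_top, eq_top_iff]
  intro f _
  induction f using Finsupp.induction_linear with
  | zero => exact zero_mem _
  | add f g hf hg => exact add_mem (hf trivial) (hg trivial)
  | single w a =>
    have := Submodule.smul_mem _ a (key w)
    simpa using this

/-- The basis `T_w`, `w ∈ W`, of the Hecke algebra. -/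
noncomputable def heckeT : Module.Basis W Scalars (Hecke cs) :=
  Module.Basis.ofRepr
    (LinearEquiv.ofBijective (heckeCoord cs) ⟨heckeCoord_injective cs, heckeCoord_surjective cs⟩)

theorem heckeT_repr (h : Hecke cs) : (heckeT cs).repr h = heckeCoord cs h := rfl

theorem heckeCoord_heckeT (w : W) : heckeCoord cs (heckeT cs w) = Finsupp.single w 1 := by
  rw [← heckeT_repr, Module.Basis.repr_self]

theorem heckeT_one : heckeT cs 1 = 1 := by
  apply heckeCoord_injective cs
  rw [heckeCoord_heckeT]; rfl

theorem heckeT_simple (i : B) :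
    heckeT cs (cs.simple i) = ⟨leftOp cs i, Algebra.subset_adjoin ⟨i, rfl⟩⟩ := by
  apply heckeCoord_injective cs
  rw [heckeCoord_heckeT]
  change _ = leftOp cs i (Finsupp.single 1 1)
  rw [leftOp_single, if_pos (by simp)]; simp

theorem heckeCoord_mul_simple (h : Hecke cs) (i : B) :
    heckeCoord cs (h * heckeT cs (cs.simple i)) = rightOp cs i (heckeCoord cs h) := by
  have h1 : heckeCoord cs (heckeT cs (cs.simple i)) = rightOp cs i (Finsupp.single 1 1) := by
    rw [heckeCoord_heckeT, rightOp_single, if_pos (by simp)]; simp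
  change h.1 (heckeCoord cs (heckeT cs (cs.simple i))) = _
  rw [h1]
  change (h.1 * rightOp cs i) _ = _
  rw [hecke_comm_rightOp]; rfl

/-- The multiplication law of the Hecke algebra. -/
theorem heckeT_mul_simple (w : W) (i : B) :
    heckeT cs w * heckeT cs (cs.simple i) =
      if cs.length w < cs.length (w * cs.simple i) then heckeT cs (w * cs.simple i)
      else q • heckeT cs (w * cs.simple i) + (q - 1) • heckeT cs w := by
  apply heckeCoord_injective cs
  rw [heckeCoord_mul_simple, heckeCoord_heckeT, rightOp_single]
  split_ifs <;> simp only [map_add, map_smul, heckeCoord_heckeT]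

theorem heckeT_simple_mul (w : W) (i : B) :
    heckeT cs (cs.simple i) * heckeT cs w =
      if cs.length w < cs.length (cs.simple i * w) then heckeT cs (cs.simple i * w)
      else q • heckeT cs (cs.simple i * w) + (q - 1) • heckeT cs w := by
  apply heckeCoord_injective cs
  rw [heckeT_simple]
  change leftOp cs i (heckeCoord cs (heckeT cs w)) = _
  rw [heckeCoord_heckeT, leftOp_single]
  split_ifs <;> simp only [map_add, map_smul, heckeCoord_heckeT]

theorem heckeT_simple_sq (i : B) : heckeT cs (cs.simple i) * heckeT cs (cs.simple i) =
    q • 1 + (q - 1) • heckeT cs (cs.simple i) := by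
  rw [heckeT_mul_simple, if_neg (by simp)]
  simp [heckeT_one]

theorem heckeT_simple_mul_inv (i : B) : heckeT cs (cs.simple i) *
    (qHalf (-2) • (heckeT cs (cs.simple i) - (q - 1) • (1 : Hecke cs))) = 1 := by
  rw [mul_smul_comm, mul_sub, heckeT_simple_sq, mul_smul_comm, mul_one, add_sub_cancel_right,
    smul_smul, mul_comm, q_mul_qHalf, one_smul]

theorem heckeT_simple_inv_mul (i : B) :
    (qHalf (-2) • (heckeT cs (cs.simple i) - (q - 1) • (1 : Hecke cs))) * heckeT cs (cs.simple i) = 1 := by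
  rw [smul_mul_assoc, sub_mul, heckeT_simple_sq, smul_mul_assoc, one_mul, add_sub_cancel_right,
    smul_smul, mul_comm, q_mul_qHalf, one_smul]

/-- The elements `T_w` are invertible. -/
theorem isUnit_heckeT (w : W) : IsUnit (heckeT cs w) := by
  induction hn : cs.length w using Nat.strong_induction_on generalizing w with
  | _ n ih =>
    subst hn
    by_cases hw : w = 1
    · subst hw; rw [heckeT_one]; exact isUnit_one
    · obtain ⟨i, hi⟩ := cs.exists_rightDescent_of_ne_one hw
      have h1 := heckeT_mul_simple cs (w * cs.simple i) i
      rw [CoxeterSystem.simple_mul_simple_cancel_right] at h1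
      replace h1 := h1.trans (if_pos hi)
      rw [← h1]
      exact (ih _ hi _ rfl).mul
        ⟨⟨_, _, heckeT_simple_mul_inv cs i, heckeT_simple_inv_mul cs i⟩, rfl⟩


/-! ### The bar involution of the Hecke algebra -/

theorem heckeT_inverse_mul_cancel (w : W) : Ring.inverse (heckeT cs w) * heckeT cs w = 1 :=
  Ring.inverse_mul_cancel _ (isUnit_heckeT cs w)

theorem heckeT_mul_inverse_cancel (w : W) : heckeT cs w * Ring.inverse (heckeT cs w) = 1 :=
  Ring.mul_inverse_cancel _ (isUnit_heckeT cs w)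

theorem hecke_induction {p : Hecke cs → Prop} (zero : p 0) (add : ∀ x y, p x → p y → p (x + y))
    (smul : ∀ (c : Scalars) x, p x → p (c • x)) (basis : ∀ w, p (heckeT cs w)) (h : Hecke cs) :
    p h := by
  have hh : h ∈ Submodule.span Scalars (Set.range (heckeT cs)) := by
    rw [(heckeT cs).span_eq]; trivial
  induction hh using Submodule.span_induction with
  | mem x hx => obtain ⟨w, rfl⟩ := hx; exact basis w
  | zero => exact zero
  | add x y _ _ hx hy => exact add x y hx hy
  | smul c x _ hx => exact smul c x hx

/-- The map `ι`, extended semilinearly from `ι(T_w) = (T_{w⁻¹})⁻¹` and `ι(q^{1/2}) = q^{-1/2}`. -/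
noncomputable def heckeBarSemilinear : Hecke cs →ₛₗ[scalarBar] Hecke cs where
  toFun h := ((heckeT cs).repr h).sum fun w c => scalarBar c • Ring.inverse (heckeT cs w⁻¹)
  map_add' h h' := by
    rw [map_add, Finsupp.sum_add_index']
    · intro w; simp
    · intro w c c'; rw [map_add, add_smul]
  map_smul' r h := by
    rw [map_smul, Finsupp.sum_smul_index', Finsupp.smul_sum]
    · simp only [smul_eq_mul, map_mul, mul_smul]
    · intro w; simp

theorem heckeBarSemilinear_heckeT (w : W) :
    heckeBarSemilinear cs (heckeT cs w) = Ring.inverse (heckeT cs w⁻¹) := by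
  change (((heckeT cs).repr (heckeT cs w)).sum
    fun w c => scalarBar c • Ring.inverse (heckeT cs w⁻¹)) = _
  rw [Module.Basis.repr_self, Finsupp.sum_single_index] <;> simp

theorem heckeT_mul_simple_of_lt {w : W} {i : B} (h : cs.length w < cs.length (w * cs.simple i)) :
    heckeT cs w * heckeT cs (cs.simple i) = heckeT cs (w * cs.simple i) := by
  rw [heckeT_mul_simple, if_pos h]

theorem heckeBarSemilinear_mul_simple_of_lt {w : W} {i : B}
    (h : cs.length w < cs.length (w * cs.simple i)) :
    Ring.inverse (heckeT cs (w * cs.simple i)⁻¹) =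
      Ring.inverse (heckeT cs w⁻¹) * Ring.inverse (heckeT cs (cs.simple i)) := by
  have h1 : heckeT cs (cs.simple i) * heckeT cs w⁻¹ = heckeT cs (w * cs.simple i)⁻¹ := by
    rw [heckeT_simple_mul, mul_inv_rev, cs.inv_simple, if_pos]
    rw [← cs.length_inv (cs.simple i * w⁻¹), cs.length_inv w]
    simpa using h
  rw [← h1]
  have h2 := isUnit_heckeT cs (cs.simple i)
  have h3 := isUnit_heckeT cs w⁻¹
  apply (h2.mul h3).mul_right_cancel
  rw [Ring.inverse_mul_cancel _ (h2.mul h3), mul_assoc, ← mul_assoc (Ring.inverse (heckeT cs (cs.simple i))),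
    Ring.inverse_mul_cancel _ h2, one_mul, Ring.inverse_mul_cancel _ h3]

theorem inverse_heckeT_simple (i : B) : Ring.inverse (heckeT cs (cs.simple i)) =
    qHalf (-2) • (heckeT cs (cs.simple i) - (q - 1) • (1 : Hecke cs)) := by
  apply (isUnit_heckeT cs (cs.simple i)).mul_right_cancel
  rw [heckeT_inverse_mul_cancel, heckeT_simple_inv_mul]

/-- The elements `T_s⁻¹` satisfy the quadratic relation with `q⁻¹` in place of `q`. -/
theorem inverse_heckeT_simple_sq (i : B) :
    Ring.inverse (heckeT cs (cs.simple i)) * Ring.inverse (heckeT cs (cs.simple i)) =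
      scalarBar q • 1 + (scalarBar q - 1) • Ring.inverse (heckeT cs (cs.simple i)) := by
  have hq : scalarBar q = qHalf (-2) := scalarBar_qHalf 2
  have h := q_mul_qHalf
  rw [hq]
  conv_lhs => enter [1]; rw [inverse_heckeT_simple]
  rw [smul_mul_assoc, sub_mul, heckeT_mul_inverse_cancel, smul_mul_assoc, one_mul, smul_sub,
    smul_smul]
  have : qHalf (-2) * (q - 1) = 1 - qHalf (-2) := by linear_combination h
  rw [this]
  module

theorem heckeBarSemilinear_mul_simple (h : Hecke cs) (i : B) :
    heckeBarSemilinear cs (h * heckeT cs (cs.simple i)) =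
      heckeBarSemilinear cs h * Ring.inverse (heckeT cs (cs.simple i)) := by
  induction h using hecke_induction cs with
  | zero => simp
  | add x y hx hy => rw [add_mul, map_add, hx, hy, map_add, add_mul]
  | smul c x hx => rw [smul_mul_assoc, LinearMap.map_smulₛₗ, hx, LinearMap.map_smulₛₗ, smul_mul_assoc]
  | basis w =>
    by_cases hw : cs.length w < cs.length (w * cs.simple i)
    · rw [heckeT_mul_simple_of_lt cs hw, heckeBarSemilinear_heckeT, heckeBarSemilinear_heckeT,
        heckeBarSemilinear_mul_simple_of_lt cs hw]
    · rw [heckeT_mul_simple, if_neg hw, map_add, LinearMap.map_smulₛₗ, LinearMap.map_smulₛₗ,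
        heckeBarSemilinear_heckeT, heckeBarSemilinear_heckeT, map_sub, map_one]
      have h1 : cs.length (w * cs.simple i) < cs.length (w * cs.simple i * cs.simple i) := by
        have := cs.length_mul_simple w i
        rw [CoxeterSystem.simple_mul_simple_cancel_right]; omega
      have h2 := heckeBarSemilinear_mul_simple_of_lt cs h1
      rw [CoxeterSystem.simple_mul_simple_cancel_right] at h2
      rw [h2, mul_assoc, inverse_heckeT_simple_sq, mul_add, mul_smul_comm, mul_one, mul_smul_comm]

theorem heckeBarSemilinear_mul (h h' : Hecke cs) :
    heckeBarSemilinear cs (h * h') = heckeBarSemilinear cs h * heckeBarSemilinear cs h' := by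
  induction h' using hecke_induction cs generalizing h with
  | zero => simp
  | add x y hx hy => rw [mul_add, map_add, hx, hy, map_add, mul_add]
  | smul c x hx => rw [mul_smul_comm, LinearMap.map_smulₛₗ, hx, LinearMap.map_smulₛₗ, mul_smul_comm]
  | basis w =>
    induction hn : cs.length w using Nat.strong_induction_on generalizing w h with
    | _ n ih =>
      subst hn
      by_cases hw : w = 1
      · subst hw
        rw [heckeBarSemilinear_heckeT, inv_one, heckeT_one, Ring.inverse_one, mul_one, mul_one]
      · obtain ⟨i, hi⟩ := cs.exists_rightDescent_of_ne_one hw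
        have h1 : cs.length (w * cs.simple i) < cs.length (w * cs.simple i * cs.simple i) := by
          rw [CoxeterSystem.simple_mul_simple_cancel_right]; exact hi
        have h2 := heckeT_mul_simple_of_lt cs h1
        rw [CoxeterSystem.simple_mul_simple_cancel_right] at h2
        rw [← h2, ← mul_assoc, heckeBarSemilinear_mul_simple, heckeBarSemilinear_mul_simple,
          ih _ hi _ _ rfl, mul_assoc]

/-- The bar involution `ι : ℋ → ℋ`, as a ring homomorphism. -/
noncomputable def heckeBar : Hecke cs →+* Hecke cs where
  toFun := heckeBarSemilinear cs
  map_one' := by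
    rw [← heckeT_one, heckeBarSemilinear_heckeT, inv_one, heckeT_one, Ring.inverse_one]
  map_mul' := heckeBarSemilinear_mul cs
  map_zero' := map_zero _
  map_add' := map_add _

theorem heckeBar_heckeT (w : W) : heckeBar cs (heckeT cs w) = Ring.inverse (heckeT cs w⁻¹) :=
  heckeBarSemilinear_heckeT cs w

theorem heckeBar_smul (r : Scalars) (h : Hecke cs) :
    heckeBar cs (r • h) = scalarBar r • heckeBar cs h :=
  LinearMap.map_smulₛₗ (heckeBarSemilinear cs) r h

/-! ### The generalized Temperley-Lieb algebra -/

/-- The subgroup `⟨s, s'⟩` of `W`. -/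
def dihedralSubgroup (i j : B) : Subgroup W := Subgroup.closure {cs.simple i, cs.simple j}

/-- The element `∑_{w ∈ ⟨s, s'⟩} T_w`. -/
noncomputable def dihedralSum (i j : B) : Hecke cs :=
  ∑ᶠ w ∈ (dihedralSubgroup cs i j : Set W), heckeT cs w

/-- The ideal `J`, generated by the elements `∑_{w ∈ ⟨s, s'⟩} T_w`, for all pairs of non-commuting
generators `s`, `s'` such that `s s'` has finite order. -/
noncomputable def tlIdeal : TwoSidedIdeal (Hecke cs) :=
  TwoSidedIdeal.span {h | ∃ i j : B, ¬ Commute (cs.simple i) (cs.simple j) ∧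
    IsOfFinOrder (cs.simple i * cs.simple j) ∧ h = dihedralSum cs i j}

/-- The generalized Temperley-Lieb algebra `TL = ℋ / J`. -/
abbrev TL : Type _ := (tlIdeal cs).ringCon.Quotient

/-- The canonical projection `σ : ℋ → TL`. -/
noncomputable def tlProj : Hecke cs →+* TL cs := (tlIdeal cs).ringCon.mk'

/-- The elements `t_w = σ(T_w)`. -/
noncomputable def tlT (w : W) : TL cs := tlProj cs (heckeT cs w)

theorem tlProj_smul (r : Scalars) (h : Hecke cs) : tlProj cs (r • h) = r • tlProj cs h := rfl

theorem isUnit_tlT (w : W) : IsUnit (tlT cs w) := (isUnit_heckeT cs w).map (tlProj cs)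

theorem heckeCoord_rightOp (f : W →₀ Scalars) (i : B) (u : W) :
    rightOp cs i f u = if cs.length (u * cs.simple i) < cs.length u then
      f (u * cs.simple i) + (q - 1) * f u else q * f (u * cs.simple i) := by
  classical
  induction f using Finsupp.induction_linear with
  | zero => simp
  | add f g hf hg =>
    rw [map_add, Finsupp.add_apply, hf, hg]
    split_ifs <;> simp only [Finsupp.add_apply] <;> ring
  | single w c =>
    have h1 : Finsupp.single w c = c • Finsupp.single w (1 : Scalars) := by simp
    rw [h1, map_smul, rightOp_single]
    have h2 : w = u * cs.simple i ↔ w * cs.simple i = u := by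
      constructor
      · rintro rfl; simp
      · rintro rfl; simp
    have h3 := cs.length_mul_simple_ne u i
    by_cases hw : w = u * cs.simple i
    · have hw' := h2.1 hw
      have hwu : w ≠ u := by
        rintro rfl
        exact cs.length_mul_simple_ne w i (congrArg cs.length hw.symm)
      rw [hw', ← hw]
      by_cases hc : cs.length w < cs.length u
      · simp [hc, hwu]
      · simp [hc, hwu, mul_comm]
    · have hw' : w * cs.simple i ≠ u := fun h => hw (h2.2 h)
      by_cases hwu : w = u
      · subst hwu
        have hc : cs.length w < cs.length (w * cs.simple i) ↔
          ¬ cs.length (w * cs.simple i) < cs.length w := by omega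
        by_cases hc' : cs.length (w * cs.simple i) < cs.length w <;>
          simp [hc, hc', hw, hw', mul_comm]
      · split_ifs <;> simp [hw, hw', hwu]

open Classical in
theorem heckeCoord_dihedralSum {i j : B} (hfin : (dihedralSubgroup cs i j : Set W).Finite) (u : W) :
    heckeCoord cs (dihedralSum cs i j) u = if u ∈ dihedralSubgroup cs i j then 1 else 0 := by
  rw [dihedralSum, finsum_mem_eq_finite_toFinset_sum _ hfin, map_sum, Finsupp.finsetSum_apply]
  simp only [heckeCoord_heckeT, Finsupp.single_apply]
  rw [Finset.sum_ite_eq']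
  simp

theorem mul_simple_mem_dihedral {i j k : B} (hk : k = i ∨ k = j) (u : W) :
    u * cs.simple k ∈ dihedralSubgroup cs i j ↔ u ∈ dihedralSubgroup cs i j := by
  apply Subgroup.mul_mem_cancel_right
  apply Subgroup.subset_closure
  rcases hk with rfl | rfl <;> simp

theorem dihedral_induction {i j : B} {p : W → Prop} (one : p 1)
    (mul : ∀ u ∈ dihedralSubgroup cs i j, ∀ k, (k = i ∨ k = j) → p u → p (u * cs.simple k))
    {w : W} (hw : w ∈ dihedralSubgroup cs i j) : p w := by
  induction hw using Subgroup.closure_induction_right with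
  | one => exact one
  | mul_right u hu y hy ih =>
    rcases hy with rfl | rfl
    · exact mul u hu i (Or.inl rfl) ih
    · exact mul u hu j (Or.inr rfl) ih
  | mul_inv_cancel u hu y hy ih =>
    rcases hy with rfl | rfl
    · rw [cs.inv_simple]; exact mul u hu i (Or.inl rfl) ih
    · rw [cs.inv_simple]; exact mul u hu j (Or.inr rfl) ih

theorem dihedralSum_mul_simple {i j k : B} (hfin : (dihedralSubgroup cs i j : Set W).Finite)
    (hk : k = i ∨ k = j) :
    dihedralSum cs i j * heckeT cs (cs.simple k) = q • dihedralSum cs i j := by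
  classical
  apply heckeCoord_injective cs
  rw [heckeCoord_mul_simple, map_smul]
  ext1 u
  rw [heckeCoord_rightOp, Finsupp.smul_apply, heckeCoord_dihedralSum cs hfin,
    heckeCoord_dihedralSum cs hfin]
  simp only [mul_simple_mem_dihedral cs hk, smul_eq_mul]
  split_ifs <;> ring

/-- The elements of `ℋ` supported on `⟨s, s'⟩`. -/
def dihedralSupported (i j : B) : Submodule Scalars (Hecke cs) where
  carrier := {h | ∀ u ∉ dihedralSubgroup cs i j, heckeCoord cs h u = 0}
  add_mem' := by
    intro a b ha hb u hu
    rw [map_add, Finsupp.add_apply, ha u hu, hb u hu, add_zero]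
  zero_mem' := by intro u _; simp
  smul_mem' := by
    intro c x hx u hu
    rw [map_smul, Finsupp.smul_apply, hx u hu, smul_zero]

theorem mul_simple_mem_dihedralSupported {i j k : B} (hk : k = i ∨ k = j) {h : Hecke cs}
    (hh : h ∈ dihedralSupported cs i j) :
    h * heckeT cs (cs.simple k) ∈ dihedralSupported cs i j := by
  intro u hu
  have hu' := (mul_simple_mem_dihedral cs hk u).not.2 hu
  rw [heckeCoord_mul_simple, heckeCoord_rightOp, hh u hu, hh _ hu']
  simp

theorem mul_inverse_simple_mem_dihedralSupported {i j k : B} (hk : k = i ∨ k = j) {h : Hecke cs}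
    (hh : h ∈ dihedralSupported cs i j) :
    h * Ring.inverse (heckeT cs (cs.simple k)) ∈ dihedralSupported cs i j := by
  rw [inverse_heckeT_simple, mul_smul_comm, mul_sub, mul_smul_comm, mul_one]
  exact Submodule.smul_mem _ _ (Submodule.sub_mem _ (mul_simple_mem_dihedralSupported cs hk hh)
    (Submodule.smul_mem _ _ hh))

theorem heckeBar_heckeT_mem_dihedralSupported {i j : B} {w : W}
    (hw : w ∈ dihedralSubgroup cs i j) :
    heckeBar cs (heckeT cs w) ∈ dihedralSupported cs i j := by
  classical
  refine dihedral_induction cs (p := fun w => heckeBar cs (heckeT cs w) ∈ dihedralSupported cs i j)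
    ?_ ?_ hw
  · intro u hu
    rw [heckeT_one, map_one, ← heckeT_one, heckeCoord_heckeT, Finsupp.single_apply, if_neg]
    rintro rfl
    exact hu (one_mem _)
  · intro u hu k hk ih
    rcases cs.length_mul_simple u k with h | h
    · rw [← heckeT_mul_simple_of_lt cs (by omega), map_mul, heckeBar_heckeT cs (cs.simple k),
        cs.inv_simple]
      exact mul_inverse_simple_mem_dihedralSupported cs hk ih
    · have h1 := heckeT_mul_simple_of_lt cs (w := u * cs.simple k) (i := k)
        (by rw [CoxeterSystem.simple_mul_simple_cancel_right]; omega)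
      rw [CoxeterSystem.simple_mul_simple_cancel_right] at h1
      have h2 : heckeBar cs (heckeT cs (u * cs.simple k)) =
          heckeBar cs (heckeT cs u) * heckeT cs (cs.simple k) := by
        rw [← h1]
        simp only [map_mul (heckeBar cs)]
        rw [heckeBar_heckeT cs (cs.simple k), cs.inv_simple, mul_assoc,
          heckeT_inverse_mul_cancel, mul_one]
      rw [h2]
      exact mul_simple_mem_dihedralSupported cs hk ih

theorem heckeBar_dihedralSum (i j : B) :
    ∃ c : Scalars, heckeBar cs (dihedralSum cs i j) = c • dihedralSum cs i j := by
  classical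
  by_cases hfin : (dihedralSubgroup cs i j : Set W).Finite
  · set y := heckeBar cs (dihedralSum cs i j) with hy
    have hmem : y ∈ dihedralSupported cs i j := by
      rw [hy, dihedralSum, finsum_mem_eq_finite_toFinset_sum _ hfin, map_sum]
      refine Submodule.sum_mem _ fun w hw => ?_
      exact heckeBar_heckeT_mem_dihedralSupported cs (by simpa using hw)
    have heig : ∀ k, (k = i ∨ k = j) → y * heckeT cs (cs.simple k) = q • y := by
      intro k hk
      have h1 := congrArg (heckeBar cs) (dihedralSum_mul_simple cs hfin hk)
      rw [map_mul, heckeBar_smul, heckeBar_heckeT, cs.inv_simple, ← hy] at h1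
      have h2 := congrArg (fun z => q • (z * heckeT cs (cs.simple k))) h1
      simp only [mul_assoc, heckeT_inverse_mul_cancel, mul_one, smul_mul_assoc, smul_smul] at h2
      have h3 : q * scalarBar q = 1 := by
        rw [show scalarBar q = qHalf (-2) from scalarBar_qHalf 2, q_mul_qHalf]
      rw [h3, one_smul] at h2
      exact h2.symm
    have hstep : ∀ k, (k = i ∨ k = j) → ∀ u, cs.length (u * cs.simple k) < cs.length u →
        heckeCoord cs y (u * cs.simple k) = heckeCoord cs y u := by
      intro k hk u hu
      have h1 := congrArg (fun z => heckeCoord cs z u) (heig k hk)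
      simp only [heckeCoord_mul_simple, heckeCoord_rightOp, if_pos hu, map_smul,
        Finsupp.smul_apply, smul_eq_mul] at h1
      linear_combination h1
    have hconst : ∀ u ∈ dihedralSubgroup cs i j, heckeCoord cs y u = heckeCoord cs y 1 := by
      intro u hu
      refine dihedral_induction cs (p := fun u => heckeCoord cs y u = heckeCoord cs y 1) rfl ?_ hu
      intro u _ k hk ih
      rcases cs.length_mul_simple u k with h | h
      · rw [← ih, ← hstep k hk (u * cs.simple k)
          (by rw [CoxeterSystem.simple_mul_simple_cancel_right]; omega),
          CoxeterSystem.simple_mul_simple_cancel_right]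
      · rw [← ih, hstep k hk u (by omega)]
    refine ⟨heckeCoord cs y 1, heckeCoord_injective cs ?_⟩
    ext1 u
    rw [map_smul, Finsupp.smul_apply, heckeCoord_dihedralSum cs hfin]
    by_cases hu : u ∈ dihedralSubgroup cs i j
    · simp [hu, hconst u hu]
    · simp [hu, hmem u hu]
  · refine ⟨1, ?_⟩
    have : dihedralSum cs i j = 0 := by
      apply finsum_mem_eq_zero_of_infinite
      refine Set.Infinite.mono (s := (dihedralSubgroup cs i j : Set W)) ?_ hfin
      intro w hw
      refine ⟨hw, ?_⟩
      intro h0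
      have h1 := congrArg (heckeCoord cs) (show heckeT cs w = 0 from h0)
      rw [heckeCoord_heckeT, map_zero, Finsupp.single_eq_zero] at h1
      have h2 := congrArg (fun z : ℤ[T;T⁻¹] => z.coeff 0) (show (1 : ℤ[T;T⁻¹]) = 0 from h1)
      simp at h2
    rw [this]; simp

/-- `ι` preserves the ideal `J`. -/
theorem heckeBar_mem_tlIdeal {h : Hecke cs} (hh : h ∈ tlIdeal cs) :
    heckeBar cs h ∈ tlIdeal cs := by
  have : tlIdeal cs ≤ TwoSidedIdeal.comap (heckeBar cs) (tlIdeal cs) := by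
    conv_lhs => rw [tlIdeal]
    rw [TwoSidedIdeal.span_le]
    rintro _ ⟨i, j, hc, ho, rfl⟩
    change _ ∈ TwoSidedIdeal.comap _ _
    rw [TwoSidedIdeal.mem_comap]
    obtain ⟨c, hc'⟩ := heckeBar_dihedralSum cs i j
    rw [hc', Algebra.smul_def]
    exact TwoSidedIdeal.mul_mem_left _ _ _ (TwoSidedIdeal.subset_span ⟨i, j, hc, ho, rfl⟩)
  exact (TwoSidedIdeal.mem_comap _).1 (this hh)

/-- The involution of `TL` induced by `ι`. -/
noncomputable def tlBar : TL cs →+* TL cs :=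
  (tlIdeal cs).ringCon.lift ((tlProj cs).comp (heckeBar cs)) (by
    intro x y hxy
    have h1 : x - y ∈ tlIdeal cs := (TwoSidedIdeal.rel_iff _ _ _).1 hxy
    have h2 := heckeBar_mem_tlIdeal cs h1
    rw [map_sub] at h2
    exact (RingCon.eq _).2 ((TwoSidedIdeal.rel_iff _ _ _).2 h2))

theorem tlBar_tlProj (h : Hecke cs) : tlBar cs (tlProj cs h) = tlProj cs (heckeBar cs h) := rfl


/-! ### Kazhdan-Lusztig basis, IC basis and the polynomials `a_{x,w}` -/

/-- The value `p(q^{n/2})` of `p ∈ ℤ[X]`. -/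
noncomputable def evalHalf (n : ℤ) (p : Polynomial ℤ) : Scalars := Polynomial.aeval (qHalf n) p

/-- The family `C_w`, `w ∈ W`, is the basis of `ℋ` with
(i) `ι(C_w) = C_w`,
(ii) `C_w = ε_w q^{ℓ(w)/2} ∑_{x ≤ w} ε_x q^{-ℓ(x)} P_{x,w}(q⁻¹) T_x`, where `ε_x = (-1)^{ℓ(x)}`,
and `P_{x,w}` are the Kazhdan-Lusztig polynomials. -/
structure IsKazhdanLusztig (C : Module.Basis W Scalars (Hecke cs))
    (P : W → W → Polynomial ℤ) : Prop where
  bar_eq : ∀ w, heckeBar cs (C w) = C w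
  eq_sum : ∀ w, C w = ((-1) ^ cs.length w * qHalf (cs.length w)) •
    ∑ x ∈ bruhatIic cs w, ((-1) ^ cs.length x * qHalf (-2 * cs.length x) *
      evalHalf (-2) (P x w)) • heckeT cs x
  poly_self : ∀ w, P w w = 1
  degree_le : ∀ x w, BruhatLT cs x w →
    2 * (P x w).natDegree + cs.length x + 1 ≤ cs.length w

/-- The element `C'_w = q^{-ℓ(w)/2} ∑_{x ≤ w} P_{x,w}(q) T_x`. -/
noncomputable def klPrime (P : W → W → Polynomial ℤ) (w : W) : Hecke cs :=
  qHalf (-cs.length w) • ∑ x ∈ bruhatIic cs w, evalHalf 2 (P x w) • heckeT cs x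

/-- The family `c_w`, `w ∈ W_c`, is the IC basis of `TL`: the basis with
(i) `ι(c_w) = c_w`,
(ii) `c_w = ∑_{x ∈ W_c, x ≤ w} q^{-ℓ(x)/2} L_{x,w}(q^{-1/2}) t_x`, where `L_{w,w} = 1` and
`L_{x,w}(q^{-1/2}) ∈ q^{-1/2} ℤ[q^{-1/2}]` for `x < w`. -/
structure IsICBasis (c : Module.Basis {w : W // IsFullyCommutative cs w} Scalars (TL cs))
    (L : W → W → Polynomial ℤ) : Prop where
  bar_eq : ∀ w, tlBar cs (c w) = c w
  eq_sum : ∀ w, c w = ∑ x ∈ bruhatIicFC cs w.1,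
    (qHalf (-cs.length x) * evalHalf (-1) (L x w.1)) • tlT cs x
  poly_self : ∀ w, IsFullyCommutative cs w → L w w = 1
  coeff_zero : ∀ x w, IsFullyCommutative cs x → IsFullyCommutative cs w → BruhatLT cs x w →
    (L x w).coeff 0 = 0

/-- The relation `σ(C'_w) = c_w` for `w ∈ W_c` and `σ(C'_w) = 0` for `w ∉ W_c`, where `C'_w` is
the Kazhdan-Lusztig basis of `ℋ` and `c_w` is the IC basis of `TL`. -/
def ProjectsKLToIC : Prop :=
  ∃ (C : Module.Basis W Scalars (Hecke cs)) (P : W → W → Polynomial ℤ)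
    (c : Module.Basis {w : W // IsFullyCommutative cs w} Scalars (TL cs))
    (L : W → W → Polynomial ℤ),
    IsKazhdanLusztig cs C P ∧ IsICBasis cs c L ∧
      (∀ w, tlProj cs (klPrime cs P w.1) = c w) ∧
      ∀ w, ¬ IsFullyCommutative cs w → tlProj cs (klPrime cs P w) = 0

/-- The polynomials `a_{x,w}`, `x, w ∈ W_c`, with `a_{x,w} = 0` unless `x ≤ w`, `a_{w,w} = 1`, and
`(t_{w⁻¹})⁻¹ = q^{-ℓ(w)} ∑_{x ∈ W_c, x ≤ w} a_{x,w}(q) t_x`. -/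
structure IsInversePolynomials (a : W → W → Polynomial ℤ) : Prop where
  inverse_eq : ∀ w, IsFullyCommutative cs w → Ring.inverse (tlT cs w⁻¹) =
    qHalf (-2 * cs.length w) • ∑ x ∈ bruhatIicFC cs w, evalHalf 2 (a x w) • tlT cs x
  poly_self : ∀ w, IsFullyCommutative cs w → a w w = 1
  eq_zero : ∀ x w, IsFullyCommutative cs x → IsFullyCommutative cs w → ¬ BruhatLE cs x w →
    a x w = 0

end CoxeterTL

/-! The argument works in the normalized monomials `q^{-ℓ(w)/2} t_w`, written t̃_w below. For w ∈
W_c the IC basis is unitriangular in them with coefficients `L_{x,w}(q^{-1/2})`, so they form a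
basis of `TL`. For arbitrary w ∈ W, the hypothesis on `σ(C'_w)` together with the Kazhdan–Lusztig
degree bound expresses t̃_w through shorter t̃_y with coefficients in `ℤ[q^{-1/2}]`, so by induction
on length all its coordinates lie in `ℤ[q^{-1/2}]` (`ProjectsKLToIC.exists_basis`).

Call y ∈ W_c bad for s if y < ys ∉ W_c. The heart of the proof is that an element u with `u t_s = q
u` has zero coefficient u_x at every bad x (`repr_eq_zero_of_mul_simple`). Comparing coefficients of
t̃_x in `u t_s = q u`, only bad y contribute, and for these `t̃_y t_s = q^{1/2} t̃_{ys}`. Hence u_x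
is `q^{-1/2}` times a `ℤ[q^{-1/2}]`-combination of the u_y with y bad. Iterating pushes the degree
of u_x below every bound, so u_x = 0.

Since `(1 + t_s) t_s = q (1 + t_s)`, this applies to `u(1 + t_s)` for every u: on the coefficient of
t̃_x, right multiplication by t_s acts as -1 (`repr_mul_simple_eq_neg`). Then `t_s⁻¹ = q⁻¹(t_s - (q
- 1))` also acts as -1, and applying this to `(t_{w⁻¹})⁻¹ = (t_{(ws)⁻¹})⁻¹ t_s⁻¹` gives the
recursion, the factor q being `q^{ℓ(w)-ℓ(ws)}`. -/

namespace CoxeterTL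

/-! ### The subring `ℤ[q^{-1/2}]` of the scalars -/

/-- The subring `ℤ[q^{-1/2}]` of `𝒜`. -/
noncomputable def negScalars : Subring Scalars :=
  (Polynomial.aeval (R := ℤ) (qHalf (-1))).toRingHom.range

theorem evalHalf_neg_one_mem (p : Polynomial ℤ) : evalHalf (-1) p ∈ negScalars := ⟨p, rfl⟩

theorem qHalf_pow (m : ℤ) (n : ℕ) : qHalf m ^ n = qHalf (n * m) := by
  induction n with
  | zero => simp [qHalf_zero]
  | succ n ih => rw [pow_succ, ih, ← qHalf_add]; congr 1; push_cast; ring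

theorem qHalf_neg_mem (n : ℕ) : qHalf (-n) ∈ negScalars := by
  have h : qHalf (-1) ∈ negScalars := ⟨Polynomial.X, by simp⟩
  have := pow_mem h n
  rwa [qHalf_pow, mul_neg_one] at this

theorem qHalf_mul_cancel (n : ℤ) (f : Scalars) : qHalf (-n) * (qHalf n * f) = f := by
  rw [← mul_assoc, ← qHalf_add, neg_add_cancel, qHalf_zero, one_mul]

/-- Every monomial `q^k` of `p(q)` has `2k ≤ n`, so no positive power of `q^{1/2}` survives. Applied
with `n = ℓ(w) - ℓ(y)` and `p = P_{y,w}`. -/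
theorem qHalf_mul_evalHalf_two_mem {n : ℕ} {p : Polynomial ℤ} (h : 2 * p.natDegree ≤ n) :
    qHalf (-n) * evalHalf 2 p ∈ negScalars := by
  rw [evalHalf, Polynomial.aeval_eq_sum_range, Finset.mul_sum]
  refine sum_mem fun k hk => ?_
  rw [Finset.mem_range] at hk
  rw [mul_smul_comm, qHalf_pow, ← qHalf_add]
  have : (-n + k * 2 : ℤ) = -((n - 2 * k : ℕ) : ℤ) := by
    rw [Nat.cast_sub (by omega)]; push_cast; ring
  rw [this]
  exact zsmul_mem (qHalf_neg_mem _) _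

theorem scalars_induction {p : Scalars → Prop} (add : ∀ f g, p f → p g → p (f + g))
    (zsmul_qHalf : ∀ (n a : ℤ), p (a • qHalf n)) (f : Scalars) : p f := by
  refine LaurentPolynomial.induction_on' (R := ℤ) (motive := p) f add fun n a => ?_
  have h := zsmul_qHalf n a
  rw [Algebra.smul_def] at h
  exact h

/-- The coefficient of `q^{n/2}`. -/
noncomputable def scalarCoeff (n : ℤ) : Scalars →+ ℤ :=
  (Finsupp.applyAddHom n).comp
    (AddMonoidAlgebra.coeffAddEquiv : ℤ[T;T⁻¹] ≃+ (ℤ →₀ ℤ)).toAddMonoidHom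

theorem scalarCoeff_qHalf (n m : ℤ) : scalarCoeff n (qHalf m) = if m = n then 1 else 0 := by
  classical
  exact Finsupp.single_apply

theorem scalars_ext {f g : Scalars} (h : ∀ n, scalarCoeff n f = scalarCoeff n g) : f = g :=
  (AddMonoidAlgebra.coeffAddEquiv : ℤ[T;T⁻¹] ≃+ (ℤ →₀ ℤ)).injective (Finsupp.ext h)

theorem scalarCoeff_mul_qHalf (f : Scalars) (m n : ℤ) :
    scalarCoeff (m + n) (f * qHalf n) = scalarCoeff m f := by
  induction f using scalars_induction with
  | add f g hf hg => rw [add_mul, map_add, map_add, hf, hg]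
  | zsmul_qHalf k a =>
    rw [smul_mul_assoc, ← qHalf_add, map_zsmul, map_zsmul, scalarCoeff_qHalf, scalarCoeff_qHalf]
    simp only [add_left_inj]

theorem evalHalf_monomial (n : ℤ) (k : ℕ) (a : ℤ) :
    evalHalf n (Polynomial.monomial k a) = a • qHalf (k * n) := by
  rw [evalHalf, Polynomial.aeval_monomial, qHalf_pow, ← Algebra.smul_def]

theorem scalarCoeff_eq_zero_of_mem_negScalars {f : Scalars} (hf : f ∈ negScalars) {n : ℤ}
    (hn : 0 < n) : scalarCoeff n f = 0 := by
  obtain ⟨p, rfl⟩ := hf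
  change scalarCoeff n (evalHalf (-1) p) = 0
  induction p using Polynomial.induction_on' with
  | add p r hp hr => rw [evalHalf, map_add, map_add, ← evalHalf, ← evalHalf, hp, hr, add_zero]
  | monomial k a =>
    rw [evalHalf_monomial, map_zsmul, scalarCoeff_qHalf, if_neg (by omega), smul_zero]

/-- The hypothesis bounds the degree of `f` in `q^{1/2}` by `d - n` for every `n`, which no nonzero
Laurent polynomial allows. This ends the degree descent. -/
theorem eq_zero_of_forall_mul_qHalf_mem {f : Scalars} (d : ℤ)
    (hf : ∀ n : ℕ, f * qHalf (n - d) ∈ negScalars) : f = 0 := by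
  refine scalars_ext fun m => ?_
  -- The shift is large enough to move the coefficient at `m` to a positive exponent, where elements
  -- of `ℤ[q^{-1/2}]` have none.
  rw [map_zero, ← scalarCoeff_mul_qHalf f m ((d - m + 1).toNat - d)]
  exact scalarCoeff_eq_zero_of_mem_negScalars (hf _) (by omega)

theorem exists_mul_qHalf_mem (f : Scalars) : ∃ d : ℕ, ∀ e : ℕ, d ≤ e →
    f * qHalf (-e) ∈ negScalars := by
  induction f using scalars_induction with
  | add f g hf hg =>
    obtain ⟨d, hd⟩ := hf
    obtain ⟨e, he⟩ := hg
    refine ⟨max d e, fun k hk => ?_⟩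
    rw [add_mul]
    exact add_mem (hd k (by omega)) (he k (by omega))
  | zsmul_qHalf n a =>
    refine ⟨n.toNat, fun e he => ?_⟩
    rw [smul_mul_assoc, ← qHalf_add]
    have : n + -(e : ℤ) = -((e - n).toNat : ℤ) := by omega
    rw [this]
    exact zsmul_mem (qHalf_neg_mem _) _

/-- The coefficient of `X^n` is recovered as that of `q^n = (q^{1/2})^{2n}`. This transfers the
final identity from `𝒜` back to `ℤ[X]`. -/
theorem evalHalf_two_injective : Function.Injective (evalHalf 2) := by
  intro p r h
  have key : ∀ (p : Polynomial ℤ) (n : ℕ), scalarCoeff (n * 2) (evalHalf 2 p) = p.coeff n := by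
    intro p n
    induction p using Polynomial.induction_on' with
    | add p r hp hr =>
      rw [evalHalf, map_add, map_add, ← evalHalf, ← evalHalf, hp, hr, Polynomial.coeff_add]
    | monomial k a =>
      rw [evalHalf_monomial, map_zsmul, scalarCoeff_qHalf, Polynomial.coeff_monomial]
      simp
  ext n
  rw [← key, ← key, h]

/-! ### Unitriangular families -/

/-- Spanning is immediate because each `c w` is a combination of the `v x`. For independence, the
triangular relation is inverted: `v w` has `c`-coordinate 1 at `w` and 0 at every other index of
level at least `l w`. No finiteness of the levels is needed, since a linear relation has finite
support. -/
theorem exists_basis_of_unitriangular {ι R V : Type*} [CommRing R] [AddCommGroup V] [Module R V]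
    (c : Module.Basis ι R V) (v : ι → V) (l : ι → ℕ)
    (h : ∀ w, ∃ f : ι →₀ R, (∀ x ∈ f.support, l x < l w) ∧
      c w = v w + Finsupp.linearCombination R v f) :
    ∃ b : Module.Basis ι R V, ⇑b = v := by
  classical
  have hspan : ⊤ ≤ Submodule.span R (Set.range v) := by
    rw [← c.span_eq, Submodule.span_le]
    rintro _ ⟨w, rfl⟩
    obtain ⟨f, -, hf⟩ := h w
    rw [hf]
    refine add_mem (Submodule.subset_span ⟨w, rfl⟩) ?_
    rw [← Finsupp.range_linearCombination]
    exact ⟨f, rfl⟩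
  have hrepr : ∀ n, ∀ w, l w = n → ∀ x, l w ≤ l x → c.repr (v w) x = if x = w then 1 else 0 := by
    intro n
    induction n using Nat.strong_induction_on with
    | _ n ih =>
      intro w hw x hx
      obtain ⟨f, hf, hc⟩ := h w
      have h1 : v w = c w - Finsupp.linearCombination R v f := by rw [hc]; abel
      have h2 : c.repr (Finsupp.linearCombination R v f) x = 0 := by
        rw [Finsupp.linearCombination_apply, Finsupp.sum, map_sum, Finsupp.finsetSum_apply]
        refine Finset.sum_eq_zero fun y hy => ?_
        have := hf y hy
        rw [map_smul, Finsupp.smul_apply, ih (l y) (by omega) y rfl x (by omega), if_neg, smul_zero]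
        rintro rfl; omega
      rw [h1, map_sub, Finsupp.sub_apply, h2, sub_zero, c.repr_self, Finsupp.single_apply]
      simp only [eq_comm]
  have hli : LinearIndependent R v := by
    rw [linearIndependent_iff]
    intro g hg
    by_contra hne
    -- At an index of maximal level in a relation, no other term contributes to the `c`-coordinate,
    -- which therefore equals `g w`.
    obtain ⟨w, hw, hmax⟩ := g.support.exists_max_image l (Finsupp.support_nonempty_iff.2 hne)
    have h1 : c.repr (Finsupp.linearCombination R v g) w = g w := by
      rw [Finsupp.linearCombination_apply, Finsupp.sum, map_sum, Finsupp.finsetSum_apply]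
      rw [Finset.sum_eq_single_of_mem w hw]
      · rw [map_smul, Finsupp.smul_apply, hrepr _ w rfl w le_rfl]; simp
      · intro y hy hyw
        rw [map_smul, Finsupp.smul_apply, hrepr _ y rfl w (hmax y hy), if_neg hyw.symm, smul_zero]
    rw [hg] at h1
    simp at h1
    exact (Finsupp.mem_support_iff.1 hw) h1.symm
  exact ⟨Module.Basis.mk hli hspan, Module.Basis.coe_mk hli hspan⟩

/-! ### Fully commutative elements -/

variable {B W : Type*} [Group W] {M : CoxeterMatrix B} (cs : CoxeterSystem M W)

theorem eq_or_length_lt_of_bruhatLE {x w : W} (h : BruhatLE cs x w) :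
    x = w ∨ cs.length x < cs.length w := by
  induction h with
  | refl => exact Or.inl rfl
  | tail _ h2 ih =>
    right
    have := h2.2
    rcases ih with rfl | ih <;> omega

theorem length_lt_of_bruhatLT {x w : W} (h : BruhatLT cs x w) : cs.length x < cs.length w :=
  (eq_or_length_lt_of_bruhatLE cs h.1).resolve_left h.2

open Classical in
/-- Deleting the last letter `i` of a word is compatible with commutation moves. -/
theorem CommutationMove.erase_last {ω ω' : List B} (h : CommutationMove cs ω ω') (i : B) :
    Relation.ReflTransGen (CommutationMove cs) (ω.reverse.erase i).reverse
      (ω'.reverse.erase i).reverse := by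
  obtain ⟨u, v, j, k, hc, rfl, rfl⟩ := h
  simp only [List.reverse_append, List.reverse_cons, List.append_assoc, List.singleton_append]
  -- If the last `i` lies in `v`, or in `u` with neither swapped letter equal to `i`, the same swap
  -- survives the deletion. If it is one of the two swapped letters, both words become equal.
  -- Reversal is needed because `List.erase` removes the first occurrence.
  by_cases hv : i ∈ v.reverse
  · rw [List.erase_append_left _ hv, List.erase_append_left _ hv]
    refine Relation.ReflTransGen.single ⟨u, (v.reverse.erase i).reverse, j, k, hc, ?_, ?_⟩ <;> simp
  · rw [List.erase_append_right _ hv, List.erase_append_right _ hv]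
    by_cases hj : j = i
    · by_cases hk : k = i
      · subst hj; subst hk; rfl
      · subst hj
        simp [hk]
        rfl
    · by_cases hk : k = i
      · subst hk
        simp [hj]
        rfl
      · refine Relation.ReflTransGen.single ⟨(u.reverse.erase i).reverse, v, j, k, hc, ?_, ?_⟩ <;>
        simp [hj, hk]

/-- Appending s to reduced words of ws gives reduced words of w, which are linked by commutations.
Deleting the last s from every word of that chain links the original words. -/
theorem IsFullyCommutative.mul_simple {w : W} (hw : IsFullyCommutative cs w) {i : B}
    (h : cs.length (w * cs.simple i) < cs.length w) :
    IsFullyCommutative cs (w * cs.simple i) := by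
  classical
  have key : ∀ ω : List B, cs.IsReduced ω → cs.wordProd ω = w * cs.simple i →
      cs.IsReduced (ω ++ [i]) ∧ cs.wordProd (ω ++ [i]) = w := by
    intro ω hω hp
    have h1 : cs.wordProd (ω ++ [i]) = w := by
      rw [cs.wordProd_append, hp]; simp
    refine ⟨?_, h1⟩
    have h2 := cs.length_mul_simple w i
    rw [CoxeterSystem.IsReduced] at hω ⊢
    rw [h1, List.length_append, ← hω, hp]
    simp; omega
  intro ω ω' hω hp hω' hp'
  obtain ⟨r1, p1⟩ := key ω hω hp
  obtain ⟨r2, p2⟩ := key ω' hω' hp'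
  have h3 := hw _ _ r1 p1 r2 p2
  have h4 : ∀ ν ν', Relation.ReflTransGen (CommutationMove cs) ν ν' →
      Relation.ReflTransGen (CommutationMove cs) (ν.reverse.erase i).reverse
      (ν'.reverse.erase i).reverse := by
    intro ν ν' hν
    induction hν with
    | refl => rfl
    | tail _ h2 ih => exact ih.trans (h2.erase_last cs i)
  simpa using h4 _ _ h3

/-! ### The normalized monomial basis of `TL` -/

/-- The elements `q^{-ℓ(w)/2} t_w` of `TL`. -/
noncomputable def tlNorm (w : W) : TL cs := qHalf (-cs.length w) • tlT cs w

theorem tlT_eq (w : W) : tlT cs w = qHalf (cs.length w) • tlNorm cs w := by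
  rw [tlNorm, smul_smul, ← qHalf_add, add_neg_cancel, qHalf_zero, one_smul]

theorem evalHalf_one (n : ℤ) : evalHalf n 1 = 1 := map_one _

/-- After normalization the coefficients of `c_w` are exactly the `L_{x,w}(q^{-1/2})`, with leading
coefficient 1 and all other terms of smaller length. So the normalized monomials are a basis and the
integrality of the coordinates is visible. -/
theorem IsICBasis.exists_basis {c : Module.Basis {w : W // IsFullyCommutative cs w} Scalars (TL cs)}
    {L : W → W → Polynomial ℤ} (hc : IsICBasis cs c L) :
    ∃ b : Module.Basis {w : W // IsFullyCommutative cs w} Scalars (TL cs),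
      (∀ w, b w = tlNorm cs w.1) ∧ ∀ w x, b.repr (c w) x ∈ negScalars := by
  classical
  have hsum : ∀ w, c w = ∑ x ∈ bruhatIicFC cs w.1, evalHalf (-1) (L x w.1) • tlNorm cs x := by
    intro w
    rw [hc.eq_sum]
    refine Finset.sum_congr rfl fun x _ => ?_
    rw [tlNorm, smul_smul, mul_comm]
  have hFC : ∀ w x, x ∈ bruhatIicFC cs w → IsFullyCommutative cs x := by
    intro w x hx
    exact (Finset.mem_filter.1 hx).2
  obtain ⟨b, hb⟩ := exists_basis_of_unitriangular c (fun w => tlNorm cs w.1)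
    (fun w => cs.length w.1) (by
      intro w
      refine ⟨∑ x ∈ ((bruhatIicFC cs w.1).erase w.1).subtype (IsFullyCommutative cs),
        Finsupp.single x (evalHalf (-1) (L x.1 w.1)), ?_, ?_⟩
      · intro x hx
        have h1 := Finsupp.support_finsetSum hx
        obtain ⟨y, hy, hxy⟩ := Finset.mem_biUnion.1 h1
        have h2 := Finsupp.support_single_subset hxy
        rw [Finset.mem_singleton] at h2
        subst h2
        rw [Finset.mem_subtype, Finset.mem_erase, bruhatIicFC, Finset.mem_filter,
          mem_bruhatIic] at hy
        exact length_lt_of_bruhatLT cs ⟨hy.2.1, hy.1⟩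
      · have hw : w.1 ∈ bruhatIicFC cs w.1 := by
          rw [bruhatIicFC, Finset.mem_filter, mem_bruhatIic]
          exact ⟨Relation.ReflTransGen.refl, w.2⟩
        rw [hsum, ← Finset.add_sum_erase _ _ hw, hc.poly_self _ w.2, evalHalf_one, one_smul,
          map_sum]
        congr 1
        simp only [Finsupp.linearCombination_single]
        rw [Finset.sum_subtype_of_mem (fun x => evalHalf (-1) (L x w.1) • tlNorm cs x)]
        intro x hx
        exact hFC _ _ (Finset.mem_of_mem_erase hx))
  refine ⟨b, fun w => congrFun hb w, ?_⟩
  intro w x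
  rw [hsum, map_sum, Finsupp.finsetSum_apply]
  refine sum_mem fun y hy => ?_
  have h1 := congrFun hb ⟨y, hFC _ _ hy⟩
  dsimp only at h1
  rw [← h1, map_smul, Finsupp.smul_apply, b.repr_self, smul_eq_mul, Finsupp.single_apply]
  split_ifs
  · rw [mul_one]; exact evalHalf_neg_one_mem _
  · rw [mul_zero]; exact zero_mem _

/-- Under the hypothesis that `σ` sends the Kazhdan-Lusztig basis to the IC basis, the elements
`q^{-ℓ(w)/2} t_w`, `w ∈ W_c`, form a basis of `TL`, and every `q^{-ℓ(w)/2} t_w`, `w ∈ W`, has its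
coordinates in `ℤ[q^{-1/2}]`. -/
theorem ProjectsKLToIC.exists_basis (hX : ProjectsKLToIC cs) :
    ∃ b : Module.Basis {w : W // IsFullyCommutative cs w} Scalars (TL cs),
      (∀ w, b w = tlNorm cs w.1) ∧ ∀ w x, b.repr (tlNorm cs w) x ∈ negScalars := by
  classical
  obtain ⟨C, P, c, L, hC, hc, h1, h2⟩ := hX
  obtain ⟨b, hb, hbc⟩ := hc.exists_basis cs
  refine ⟨b, hb, ?_⟩
  intro w x
  -- The induction runs over all of `W`: elements outside `W_c` occur below `w` in `C'_w`.
  induction hn : cs.length w using Nat.strong_induction_on generalizing w with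
  | _ n ih =>
    subst hn
    have hw : w ∈ bruhatIic cs w := (mem_bruhatIic cs).2 Relation.ReflTransGen.refl
    have hKL : tlProj cs (klPrime cs P w) = tlNorm cs w +
        ∑ y ∈ (bruhatIic cs w).erase w,
          (qHalf (-(cs.length w - cs.length y : ℕ)) * evalHalf 2 (P y w)) • tlNorm cs y := by
      rw [klPrime, tlProj_smul, map_sum, ← Finset.add_sum_erase _ _ hw, smul_add, Finset.smul_sum,
        hC.poly_self, evalHalf_one, one_smul]
      congr 1
      refine Finset.sum_congr rfl fun y hy => ?_
      rw [Finset.mem_erase, mem_bruhatIic] at hy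
      have hlt := length_lt_of_bruhatLT cs ⟨hy.2, hy.1⟩
      rw [tlProj_smul, smul_smul]
      change _ • tlT cs y = _
      rw [tlT_eq, smul_smul, Nat.cast_sub hlt.le, neg_sub, sub_eq_add_neg, qHalf_add]
      congr 1
      ring
    -- This is where the assumption on `X` enters: the projection is either an IC basis element or
    -- zero.
    have hKLmem : b.repr (tlProj cs (klPrime cs P w)) x ∈ negScalars := by
      by_cases hfc : IsFullyCommutative cs w
      · rw [h1 ⟨w, hfc⟩]; exact hbc _ _
      · rw [h2 w hfc]; simp
    rw [eq_sub_of_add_eq hKL.symm, map_sub, Finsupp.sub_apply]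
    refine sub_mem hKLmem ?_
    rw [map_sum, Finsupp.finsetSum_apply]
    refine sum_mem fun y hy => ?_
    rw [Finset.mem_erase, mem_bruhatIic] at hy
    have hlt := length_lt_of_bruhatLT cs ⟨hy.2, hy.1⟩
    have hdeg := hC.degree_le y w ⟨hy.2, hy.1⟩
    rw [map_smul, Finsupp.smul_apply, smul_eq_mul]
    exact mul_mem (qHalf_mul_evalHalf_two_mem (by omega)) (ih _ hlt y rfl)

/-! ### Right multiplication by `t_s` in `TL` -/

theorem tlT_mul_simple_of_lt {w : W} {i : B} (h : cs.length w < cs.length (w * cs.simple i)) :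
    tlT cs w * tlT cs (cs.simple i) = tlT cs (w * cs.simple i) := by
  rw [tlT, tlT, ← map_mul, heckeT_mul_simple_of_lt cs h]; rfl

theorem tlT_mul_simple_of_not_lt {w : W} {i : B}
    (h : ¬ cs.length w < cs.length (w * cs.simple i)) :
    tlT cs w * tlT cs (cs.simple i) = q • tlT cs (w * cs.simple i) + (q - 1) • tlT cs w := by
  rw [tlT, tlT, ← map_mul, heckeT_mul_simple, if_neg h, map_add, tlProj_smul, tlProj_smul]; rfl

theorem tlT_simple_sq (i : B) : tlT cs (cs.simple i) * tlT cs (cs.simple i) =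
    q • 1 + (q - 1) • tlT cs (cs.simple i) := by
  rw [tlT, ← map_mul, heckeT_simple_sq, map_add, tlProj_smul, tlProj_smul, map_one]

/-- The normalization turns a length increase of one into the factor `q^{1/2}`. Being smaller than
the eigenvalue `q`, it makes the degree descent possible. -/
theorem tlNorm_mul_simple_of_lt {w : W} {i : B} (h : cs.length w < cs.length (w * cs.simple i)) :
    tlNorm cs w * tlT cs (cs.simple i) = qHalf 1 • tlNorm cs (w * cs.simple i) := by
  have h1 := cs.length_mul_simple w i
  rw [tlNorm, smul_mul_assoc, tlT_mul_simple_of_lt cs h, tlNorm, smul_smul, ← qHalf_add]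
  congr 2
  omega

/-! ### The coefficient of t_x in u t_s for x < xs ∉ W_c. -/

variable {cs} {b : Module.Basis {w : W // IsFullyCommutative cs w} Scalars (TL cs)}

/-- If `x < xs ∉ W_c` and `y ∈ W_c` is such that `ys < y` or `ys ∈ W_c`, then `t_x` does not occur
in `t_y t_s`. -/
theorem repr_tlNorm_mul_simple_eq_zero (hb : ∀ w, b w = tlNorm cs w.1) {i : B}
    {x y : {w : W // IsFullyCommutative cs w}}
    (hx : cs.length x.1 < cs.length (x.1 * cs.simple i))
    (hx' : ¬ IsFullyCommutative cs (x.1 * cs.simple i))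
    (hy : ¬ (cs.length y.1 < cs.length (y.1 * cs.simple i) ∧
      ¬ IsFullyCommutative cs (y.1 * cs.simple i))) :
    b.repr (tlNorm cs y.1 * tlT cs (cs.simple i)) x = 0 := by
  classical
  -- If x were ys, then xs = y would be fully commutative.
  have hne : ∀ hfc : IsFullyCommutative cs (y.1 * cs.simple i),
      b.repr (tlNorm cs (y.1 * cs.simple i)) x = 0 := by
    intro hfc
    have h1 := hb ⟨_, hfc⟩
    dsimp only at h1
    rw [← h1, b.repr_self, Finsupp.single_apply, if_neg]
    rintro rfl
    apply hx'
    simpa using y.2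
  by_cases hlt : cs.length y.1 < cs.length (y.1 * cs.simple i)
  · rw [tlNorm_mul_simple_of_lt cs hlt, map_smul, Finsupp.smul_apply, hne (by tauto), smul_zero]
  · have hfc : IsFullyCommutative cs (y.1 * cs.simple i) := y.2.mul_simple cs
      (by have := cs.length_mul_simple y.1 i; omega)
    have hxy : b.repr (tlNorm cs y.1) x = 0 := by
      rw [← hb, b.repr_self, Finsupp.single_apply, if_neg]
      rintro rfl
      exact hlt hx
    have h2 : tlNorm cs y.1 * tlT cs (cs.simple i) =
        (qHalf (-cs.length y.1) * q * qHalf (cs.length (y.1 * cs.simple i))) •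
          tlNorm cs (y.1 * cs.simple i) + (q - 1) • tlNorm cs y.1 := by
      rw [show tlNorm cs y.1 = qHalf (-cs.length y.1) • tlT cs y.1 from rfl, smul_mul_assoc,
        tlT_mul_simple_of_not_lt cs hlt, tlT_eq cs (y.1 * _)]
      module
    rw [h2, map_add, map_smul, map_smul, Finsupp.add_apply, Finsupp.smul_apply,
      Finsupp.smul_apply, hxy, hne hfc, smul_zero, smul_zero, add_zero]

/-- If `u t_s = q u`, then `t_x` does not occur in `u` when `x < xs ∉ W_c`. -/
theorem repr_eq_zero_of_mul_simple (hb : ∀ w, b w = tlNorm cs w.1)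
    (hmem : ∀ w x, b.repr (tlNorm cs w) x ∈ negScalars) {i : B} {u : TL cs}
    (hu : u * tlT cs (cs.simple i) = q • u) {x : {w : W // IsFullyCommutative cs w}}
    (hx : cs.length x.1 < cs.length (x.1 * cs.simple i))
    (hx' : ¬ IsFullyCommutative cs (x.1 * cs.simple i)) :
    b.repr u x = 0 := by
  classical
  -- A common degree bound `d`, in powers of `q^{1/2}`, for the finitely many nonzero coordinates of
  -- `u`.
  obtain ⟨d, hd⟩ : ∃ d : ℕ, ∀ y ∈ (b.repr u).support, b.repr u y * qHalf (-d) ∈ negScalars := by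
    choose f hf using exists_mul_qHalf_mem
    exact ⟨(b.repr u).support.sup fun y => f (b.repr u y),
      fun y hy => hf _ _ (Finset.le_sup (f := fun y => f (b.repr u y)) hy)⟩
  -- The bound improves to `d - n` for all `n`. The claim covers every x with x < xs ∉ W_c at once,
  -- because the coefficient at one such x is controlled by those at the others.
  have key : ∀ n : ℕ, ∀ x : {w : W // IsFullyCommutative cs w},
      cs.length x.1 < cs.length (x.1 * cs.simple i) →
      ¬ IsFullyCommutative cs (x.1 * cs.simple i) →
      b.repr u x * qHalf (n - d) ∈ negScalars := by
    intro n
    induction n with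
    | zero =>
      intro x _ _
      by_cases hxs : x ∈ (b.repr u).support
      · simpa using hd x hxs
      · rw [Finsupp.notMem_support_iff.1 hxs, zero_mul]; exact zero_mem _
    | succ n ih =>
      intro x hx hx'
      have h1 : q * b.repr u x = ∑ y ∈ (b.repr u).support,
          b.repr u y * b.repr (tlNorm cs y.1 * tlT cs (cs.simple i)) x := by
        have h2 := congrArg (fun z => b.repr z x) hu
        simp only [map_smul, Finsupp.smul_apply, smul_eq_mul] at h2
        rw [← h2]
        conv_lhs => rw [← b.linearCombination_repr u]
        rw [Finsupp.linearCombination_apply, Finsupp.sum, Finset.sum_mul, map_sum,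
          Finsupp.finsetSum_apply]
        refine Finset.sum_congr rfl fun y _ => ?_
        rw [smul_mul_assoc, map_smul, Finsupp.smul_apply, smul_eq_mul, hb]
      -- Of the two half-powers gained by dividing by `q`, one pays for the factor `q^{1/2}` in
      -- `t̃_y t_s` and the other lowers the degree bound by one.
      have h3 : b.repr u x * qHalf ((n + 1 : ℕ) - d) =
          qHalf (-1) * ((q * b.repr u x) * qHalf (n - d)) := by
        have h4 : qHalf ((n + 1 : ℕ) - d) = qHalf (-1) * (q * qHalf (n - d)) := by
          rw [q, ← qHalf_add, ← qHalf_add]; congr 1; push_cast; ring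
        rw [h4]; ring
      rw [h3, h1, Finset.sum_mul, Finset.mul_sum]
      refine sum_mem fun y _ => ?_
      by_cases hy : cs.length y.1 < cs.length (y.1 * cs.simple i) ∧
          ¬ IsFullyCommutative cs (y.1 * cs.simple i)
      · rw [tlNorm_mul_simple_of_lt cs hy.1, map_smul, Finsupp.smul_apply, smul_eq_mul]
        have h5 : qHalf (-1) * (b.repr u y * (qHalf 1 *
            b.repr (tlNorm cs (y.1 * cs.simple i)) x) * qHalf (n - d)) =
            (b.repr u y * qHalf (n - d)) * b.repr (tlNorm cs (y.1 * cs.simple i)) x := by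
          have h6 := qHalf_mul_cancel 1 1
          rw [mul_one] at h6
          linear_combination (b.repr u y * qHalf (n - d) *
            b.repr (tlNorm cs (y.1 * cs.simple i)) x) * h6
        rw [h5]
        -- Here ys lies outside `W_c`, so integrality of the coordinates of t̃ is needed for all of
        -- `W`.
        exact mul_mem (ih y hy.1 hy.2) (hmem _ _)
      · rw [repr_tlNorm_mul_simple_eq_zero hb hx hx' hy, mul_zero, zero_mul, mul_zero]
        exact zero_mem _
  exact eq_zero_of_forall_mul_qHalf_mem d fun n => key n x hx hx'

/-- If `x < xs ∉ W_c`, then the coefficients of `t_x` in `u t_s` and in `-u` agree. -/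
theorem repr_mul_simple_eq_neg (hb : ∀ w, b w = tlNorm cs w.1)
    (hmem : ∀ w x, b.repr (tlNorm cs w) x ∈ negScalars) {i : B} (u : TL cs)
    {x : {w : W // IsFullyCommutative cs w}}
    (hx : cs.length x.1 < cs.length (x.1 * cs.simple i))
    (hx' : ¬ IsFullyCommutative cs (x.1 * cs.simple i)) :
    b.repr (u * tlT cs (cs.simple i)) x = - b.repr u x := by
  -- The quadratic relation gives `(t_s + 1) t_s = q (t_s + 1)`, so `u (t_s + 1)` is an eigenvector
  -- for the eigenvalue `q`.
  have h1 : (u * tlT cs (cs.simple i) + u) * tlT cs (cs.simple i) =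
      q • (u * tlT cs (cs.simple i) + u) := by
    rw [add_mul, mul_assoc, tlT_simple_sq, mul_add, mul_smul_comm, mul_smul_comm, mul_one]
    module
  have h2 := repr_eq_zero_of_mul_simple hb hmem h1 hx hx'
  rw [map_add, Finsupp.add_apply] at h2
  exact eq_neg_of_add_eq_zero_left h2

/-! ### Inverses of the t_w and the polynomials a_{x,w}. -/

theorem inverse_tlT (w : W) : Ring.inverse (tlT cs w) = tlProj cs (Ring.inverse (heckeT cs w)) := by
  apply (isUnit_tlT cs w).mul_right_cancel
  rw [Ring.inverse_mul_cancel _ (isUnit_tlT cs w), tlT, ← map_mul, heckeT_inverse_mul_cancel,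
    map_one]

/-- Since w⁻¹ = s (ws)⁻¹ with lengths adding, inversion puts `t_s⁻¹ = q⁻¹(t_s - (q - 1))` on the
right. -/
theorem inverse_tlT_inv_of_lt {w : W} {i : B} (h : cs.length (w * cs.simple i) < cs.length w) :
    Ring.inverse (tlT cs w⁻¹) = qHalf (-2) • (Ring.inverse (tlT cs (w * cs.simple i)⁻¹) *
      tlT cs (cs.simple i) - (q - 1) • Ring.inverse (tlT cs (w * cs.simple i)⁻¹)) := by
  have h1 := heckeBarSemilinear_mul_simple_of_lt cs (w := w * cs.simple i) (i := i)
    (by simpa using h)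
  rw [CoxeterSystem.simple_mul_simple_cancel_right, inverse_heckeT_simple] at h1
  rw [inverse_tlT, inverse_tlT, h1, mul_smul_comm, mul_sub, mul_smul_comm, mul_one, tlProj_smul,
    map_sub, map_mul, tlProj_smul]
  rfl

theorem IsInversePolynomials.repr_inverse {a : W → W → Polynomial ℤ}
    (ha : IsInversePolynomials cs a) (hb : ∀ w, b w = tlNorm cs w.1) {w : W}
    (hw : IsFullyCommutative cs w) (x : {w : W // IsFullyCommutative cs w}) :
    b.repr (Ring.inverse (tlT cs w⁻¹)) x =
      qHalf (-2 * cs.length w) * (evalHalf 2 (a x.1 w) * qHalf (cs.length x.1)) := by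
  classical
  have h1 : ∀ y ∈ bruhatIicFC cs w, b.repr (evalHalf 2 (a y w) • tlT cs y) x =
      if y = x.1 then evalHalf 2 (a x.1 w) * qHalf (cs.length x.1) else 0 := by
    intro y hy
    have hfc : IsFullyCommutative cs y := (Finset.mem_filter.1 hy).2
    have h2 := hb ⟨y, hfc⟩
    dsimp only at h2
    rw [tlT_eq, ← h2, map_smul, map_smul, b.repr_self, Finsupp.smul_apply, Finsupp.smul_apply,
      Finsupp.single_apply]
    by_cases hyx : y = x.1
    · subst hyx; simp
    · rw [if_neg hyx, if_neg, smul_zero, smul_zero]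
      rintro rfl; exact hyx rfl
  rw [ha.inverse_eq w hw, map_smul, Finsupp.smul_apply, smul_eq_mul, map_sum,
    Finsupp.finsetSum_apply, Finset.sum_congr rfl h1, Finset.sum_ite_eq']
  split_ifs with hxw
  · rfl
  -- For x ≰ w the sum has no term at x, and the convention `a_{x,w} = 0` makes the formula hold
  -- there too.
  · rw [ha.eq_zero x.1 w x.2 hw]
    · simp [evalHalf]
    · intro hle
      exact hxw (Finset.mem_filter.2 ⟨(mem_bruhatIic cs).2 hle, x.2⟩)

end CoxeterTL

theorem mainTheorem2 {B W : Type*} [Group W] {M : CoxeterMatrix B} (cs : CoxeterSystem M W)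
    (hX : CoxeterTL.ProjectsKLToIC cs)
    (a : W → W → Polynomial ℤ) (ha : CoxeterTL.IsInversePolynomials cs a)
    (x w : W) (hx : CoxeterTL.IsFullyCommutative cs x) (hw : CoxeterTL.IsFullyCommutative cs w)
    (i : B) (hws : CoxeterTL.BruhatLT cs (w * cs.simple i) w)
    (hxs : CoxeterTL.BruhatLT cs x (x * cs.simple i))
    (hxs' : ¬ CoxeterTL.IsFullyCommutative cs (x * cs.simple i)) :
    a x w = -Polynomial.X * a x (w * cs.simple i) := by
  open CoxeterTL in
  obtain ⟨b, hb, hmem⟩ := hX.exists_basis cs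
  have hlw := length_lt_of_bruhatLT cs hws
  have hlx := length_lt_of_bruhatLT cs hxs
  have hw' := hw.mul_simple cs hlw
  have h1 := congrArg (fun z => b.repr z ⟨x, hx⟩) (inverse_tlT_inv_of_lt (cs := cs) hlw)
  simp only [map_smul, map_sub, Finsupp.smul_apply, Finsupp.sub_apply, smul_eq_mul] at h1
  -- If `c` is the coefficient of t̃_x in `(t_{(ws)⁻¹})⁻¹`, the right side becomes `q⁻¹(-c - (q -
  -- 1)c) = -c`.
  rw [repr_mul_simple_eq_neg hb hmem _ hlx hxs', ha.repr_inverse hb hw, ha.repr_inverse hb hw']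
    at h1
  dsimp only at h1
  apply evalHalf_two_injective
  have h2 : evalHalf 2 (-Polynomial.X * a x (w * cs.simple i)) =
      -q * evalHalf 2 (a x (w * cs.simple i)) := by
    simp [evalHalf, q]
  -- From `ℓ(w) = ℓ(ws) + 1`; this discrepancy between the prefactors is the `q` of the recursion.
  have h3 : qHalf (-2) * qHalf (-2 * cs.length (w * cs.simple i)) =
      qHalf (-2 * cs.length w) := by
    have := cs.length_mul_simple w i
    rw [← qHalf_add]; congr 1; omega
  have h4 : qHalf (-2 * cs.length w) * (evalHalf 2 (a x w) * qHalf (cs.length x)) =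
      qHalf (-2 * cs.length w) * (-q * evalHalf 2 (a x (w * cs.simple i)) *
        qHalf (cs.length x)) := by
    rw [h1]
    linear_combination (-q * evalHalf 2 (a x (w * cs.simple i)) * qHalf (cs.length x)) * h3
  have h5 : ∀ n, IsUnit (qHalf n) := fun n =>
    IsUnit.of_mul_eq_one (qHalf (-n)) (by rw [← qHalf_add, add_neg_cancel, qHalf_zero])
  rw [h2]
  exact (h5 _).mul_right_cancel ((h5 _).mul_left_cancel h4)
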